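/- Let $d\ge 2$, let $\mathbb{S}^{d-1}=\{x\in\mathbb{R}^d:\langle x,x\rangle=1\}$, and let $\mu_d$ be the Lebesgue measure on $\mathbb{S}^{d-1}$ normalized by $\mu_d(\mathbb{S}^{d-1})=1$. For an integer $t\ge 0$, a finite non-empty set $X\subset\mathbb{S}^{d-1}$ is a spherical $t$-design in $\mathbb{S}^{d-1}$ if $\int_{\mathbb{S}^{d-1}}f\,d\mu_d=\frac1{|X|}\sum_{x\in X}f(x)$ for all real polynomials $f$ in $d$ variables of degree at most $t$. For finite sets $X,Y$ on the same sphere put $A(X,Y)=\{\langle x,y\rangle : x\in X,\ y\in Y,\ x\ne y\}$ and $A(X)=A(X,X)$. **Theorem.** Let $X$ be a finite non-empty subset of $\mathbb{S}^{d-1}$, let $\alpha=(1,0,\ldots,0)\in\mathbb{R}^d$, and assume that $\alpha\notin X$ and $-\alpha\notin X$. Let $B=\{\langle\alpha,x\rangle : x\in X\}=\{\beta_1,\ldots,\beta_s\}$ with $s=|B|$. For $i\in\{1,\ldots,s\}$ define the derived code $$\mathcal{D}_{\beta_i}=\Big\{\xi\in\mathbb{S}^{d-2} : \big(\beta_i,\sqrt{1-\beta_i^2}\,\xi\big)\in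 X\Big\}.$$ (i) For all $i,j\in\{1,\ldots,s\}$, $$A(\mathcal{D}_{\beta_i},\mathcal{D}_{\beta_j})\subseteq\Big\{\frac{\gamma-\beta_i\beta_j}{\sqrt{(1-\beta_i^2)(1-\beta_j^2)}} : \gamma\in A(X)\Big\}.$$ (ii) If $X$ is a spherical $t$-design in $\mathbb{S}^{d-1}$, where $t\ge0$ is an integer, then for every $i\in\{1,\ldots,s\}$ the derived code $\mathcal{D}_{\beta_i}$ is a spherical $\max(t+1-s,\,0)$-design in $\mathbb{S}^{d-2}$. -/

import Mathlib

noncomputable section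

/-- The unit sphere `S^{n-1}` of `ℝ^n`. -/
abbrev unitSphere (n : ℕ) : Set (EuclideanSpace ℝ (Fin n)) :=
  Metric.sphere (0 : EuclideanSpace ℝ (Fin n)) 1

/-- The Lebesgue (surface) measure on the unit sphere of `ℝ^n`, normalized to total mass `1`
(for `n ≥ 1`; for `n = 0` the sphere is empty). -/
def sphereMeasure (n : ℕ) : MeasureTheory.Measure (unitSphere n) :=
  ((MeasureTheory.volume : MeasureTheory.Measure (EuclideanSpace ℝ (Fin n))).toSphere
      Set.univ)⁻¹ •
    (MeasureTheory.volume : MeasureTheory.Measure (EuclideanSpace ℝ (Fin n))).toSphere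

/-- `X` is a spherical `t`-design in `S^{n-1}`: a finite nonempty subset of the sphere over which
every real polynomial of degree at most `t` has the same average as over the whole sphere. -/
structure IsSphericalDesign {n : ℕ} (t : ℕ) (X : Set (EuclideanSpace ℝ (Fin n))) : Prop where
  finite : X.Finite
  nonempty : X.Nonempty
  subset_sphere : X ⊆ unitSphere n
  integral_eq_average : ∀ f : MvPolynomial (Fin n) ℝ, f.totalDegree ≤ t →
    ∫ x : unitSphere n, MvPolynomial.eval (x : EuclideanSpace ℝ (Fin n)).ofLp f ∂(sphereMeasure n)
      = (1 / (X.ncard : ℝ)) * ∑ᶠ x ∈ X, MvPolynomial.eval x.ofLp f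

/-- The angle set `A(X, Y)`: all inner products `⟨x, y⟩` with `x ∈ X`, `y ∈ Y`, `x ≠ y`. -/
def angleSet {n : ℕ} (X Y : Set (EuclideanSpace ℝ (Fin n))) : Set ℝ :=
  {c | ∃ x ∈ X, ∃ y ∈ Y, x ≠ y ∧ inner ℝ x y = c}

/-- The vector `(1, 0, …, 0)` of `ℝ^{n+1}`. -/
def firstBasisVector (n : ℕ) : EuclideanSpace ℝ (Fin (n + 1)) :=
  EuclideanSpace.single 0 1

/-- The point `(β, √(1 - β²) ξ)` of `ℝ^{n+1} = ℝ × ℝ^n`. -/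
def liftPoint {n : ℕ} (β : ℝ) (ξ : EuclideanSpace ℝ (Fin n)) : EuclideanSpace ℝ (Fin (n + 1)) :=
  WithLp.toLp 2 (Fin.cons β (fun i => √(1 - β ^ 2) * ξ i))

/-- The derived code of `X ⊆ S^n` with respect to `(1, 0, …, 0)` and `β`: the set of all
`ξ ∈ S^{n-1}` such that `(β, √(1 - β²) ξ) ∈ X`. -/
def derivedCode {n : ℕ} (X : Set (EuclideanSpace ℝ (Fin (n + 1)))) (β : ℝ) :
    Set (EuclideanSpace ℝ (Fin n)) :=
  {ξ | ξ ∈ unitSphere n ∧ liftPoint β ξ ∈ X}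

end

/-! Part (i) is the identity ⟨x, y⟩ = x₀y₀ + ⟨x', y'⟩, with x' the last n coordinates, applied to
lifted points. For (ii), take q of degree s - 1 vanishing at every height except β, and f
homogeneous of degree k on ℝⁿ. Testing the design on q(x₀) f(x') leaves only the slice at β,
contributing q(β) (1 - β²)^(k/2) ∑ f(ξ). The sphere integral factors as ∫ q(x₀) ‖x'‖ᵏ times the mean
of f (`sphereMeasure_integral_polynomial_mul_tail`). If k is even, ‖x'‖ᵏ = (1 - x₀²)^(k/2) on the
sphere, so the design also evaluates the first factor, and division gives the claim. If k is odd,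
the mean of f is 0, which forces ∑ f(ξ) = 0. Both tests have degree at most s - 1 + k, hence the
strength t + 1 - s. -/

noncomputable section
open MeasureTheory Set Metric

/-! ### Gaussian integrals in polar coordinates -/

/-- The radial Gaussian moment `∫₀^∞ r ^ m * exp (-r ^ 2) dr`. -/
def radialGaussianMoment (m : ℕ) : ℝ :=
  ∫ r in Ioi (0 : ℝ), r ^ m * Real.exp (-r ^ 2)

theorem radialGaussianMoment_pos (m : ℕ) : 0 < radialGaussianMoment m := by
  have h := integral_rpow_mul_exp_neg_rpow (p := 2) (q := m) two_pos
    (lt_of_lt_of_le (by norm_num) (Nat.cast_nonneg m))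
  have h' : radialGaussianMoment m = 1 / 2 * Real.Gamma ((m + 1) / 2) := by
    rw [← h, radialGaussianMoment]
    simp only [Real.rpow_natCast, Real.rpow_two]
  rw [h']
  have := Real.Gamma_pos_of_pos (s := ((m : ℝ) + 1) / 2) (by positivity)
  positivity

/-- The Gaussian integral of a positively homogeneous function in polar coordinates. -/
theorem integral_homogeneous_mul_gaussian {E : Type*} [NormedAddCommGroup E] [NormedSpace ℝ E]
    [MeasurableSpace E] [BorelSpace E] [FiniteDimensional ℝ E] [Nontrivial E]
    (μ : Measure E) [μ.IsAddHaarMeasure] (k : ℕ) (G : E → ℝ)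
    (hG : ∀ r : ℝ, 0 < r → ∀ x, G (r • x) = r ^ k * G x) :
    ∫ x, G x * Real.exp (-‖x‖ ^ 2) ∂μ =
      (∫ x : sphere (0 : E) 1, G x ∂μ.toSphere) *
        radialGaussianMoment (Module.finrank ℝ E - 1 + k) :=
  calc
    ∫ x, G x * Real.exp (-‖x‖ ^ 2) ∂μ
        = ∫ x : ({(0)}ᶜ : Set E), G x.1 * Real.exp (-‖x.1‖ ^ 2) ∂(μ.comap (↑)) := by
      rw [integral_subtype_comap (measurableSet_singleton _).compl
        fun x ↦ G x * Real.exp (-‖x‖ ^ 2), restrict_compl_singleton]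
    _ = ∫ x : sphere (0 : E) 1 × Ioi (0 : ℝ),
          G x.1 * ((x.2 : ℝ) ^ k * Real.exp (-(x.2 : ℝ) ^ 2))
          ∂μ.toSphere.prod (.volumeIoiPow (Module.finrank ℝ E - 1)) := by
      rw [← μ.measurePreserving_homeomorphUnitSphereProd.integral_comp
        (Homeomorph.measurableEmbedding _)]
      refine integral_congr_ae (.of_forall fun x ↦ ?_)
      -- Homogeneity gives G(x) = ‖x‖ᵏ G(x/‖x‖), which separates direction from radius.
      have hx : 0 < ‖x.1‖ := norm_pos_iff.2 x.2
      have h1 := hG ‖x.1‖ hx (‖x.1‖⁻¹ • x.1)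
      rw [smul_inv_smul₀ hx.ne'] at h1
      simp only [homeomorphUnitSphereProd_apply_snd_coe, homeomorphUnitSphereProd_apply_fst_coe]
      rw [h1]
      ring
    _ = (∫ x : sphere (0 : E) 1, G x ∂μ.toSphere) * ∫ r : Ioi (0 : ℝ),
          (r : ℝ) ^ k * Real.exp (-(r : ℝ) ^ 2) ∂.volumeIoiPow (Module.finrank ℝ E - 1) :=
      integral_prod_mul (fun x : sphere (0 : E) 1 ↦ G x)
        (fun r : Ioi (0 : ℝ) ↦ (r : ℝ) ^ k * Real.exp (-(r : ℝ) ^ 2))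
    _ = _ := by
      congr 1
      simp only [Measure.volumeIoiPow, ENNReal.ofReal, radialGaussianMoment]
      rw [integral_withDensity_eq_integral_smul, integral_subtype_comap measurableSet_Ioi
          fun a : ℝ ↦ Real.toNNReal (a ^ (Module.finrank ℝ E - 1)) •
            (a ^ k * Real.exp (-a ^ 2)),
        setIntegral_congr_fun measurableSet_Ioi fun x hx ↦ ?_]
      · simp only [NNReal.smul_def, Real.coe_toNNReal _ (pow_nonneg (mem_Ioi.1 hx).le _),
          smul_eq_mul]
        ring
      · exact (measurable_subtype_coe.pow_const _).real_toNNReal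

/-! ### Separating the first coordinate in spherical integrals -/

/-- The projection of `ℝ × ℝ ^ n` to `ℝ ^ n`. -/
def euclideanTail {n : ℕ} (x : EuclideanSpace ℝ (Fin (n + 1))) : EuclideanSpace ℝ (Fin n) :=
  WithLp.toLp 2 fun i ↦ x i.succ

theorem norm_sq_eq_head_add_tail {n : ℕ} (x : EuclideanSpace ℝ (Fin (n + 1))) :
    ‖x‖ ^ 2 = x 0 ^ 2 + ‖euclideanTail x‖ ^ 2 := by
  simp [EuclideanSpace.norm_sq_eq, Fin.sum_univ_succ, euclideanTail]

theorem euclideanTail_smul {n : ℕ} (r : ℝ) (x : EuclideanSpace ℝ (Fin (n + 1))) :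
    euclideanTail (r • x) = r • euclideanTail x := by
  ext i; simp [euclideanTail]

theorem continuous_euclideanTail {n : ℕ} : Continuous (euclideanTail (n := n)) := by
  unfold euclideanTail
  fun_prop

theorem integral_head_mul_tail {n : ℕ} (a : ℝ → ℝ) (f : EuclideanSpace ℝ (Fin n) → ℝ) :
    ∫ x : EuclideanSpace ℝ (Fin (n + 1)), a (x 0) * f (euclideanTail x) =
      (∫ u, a u) * ∫ y, f y := by
  have h1 := (EuclideanSpace.volume_preserving_symm_measurableEquiv_toLp (Fin (n + 1)))
  have h2 := volume_preserving_piFinSuccAbove (fun _ : Fin (n + 1) ↦ ℝ) 0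
  have h3 := (EuclideanSpace.volume_preserving_symm_measurableEquiv_toLp (Fin n)).symm
  have h12 := (h2.comp h1)
  have e12 := h12.integral_comp ((MeasurableEquiv.piFinSuccAbove (fun _ : Fin (n + 1) ↦ ℝ)
    0).measurableEmbedding.comp (MeasurableEquiv.measurableEmbedding _))
    (fun z : ℝ × (Fin n → ℝ) ↦ a z.1 * f (WithLp.toLp 2 z.2))
  have e3 := h3.integral_comp (MeasurableEquiv.measurableEmbedding _) f
  rw [← e3]
  exact e12.trans (integral_prod_mul (μ := volume) (ν := volume) a
    fun z : Fin n → ℝ ↦ f (WithLp.toLp 2 z))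

/-- Separation of the first coordinate in the spherical integral of a product. -/
theorem toSphere_integral_pow_mul_tail {n : ℕ} (hn : n ≠ 0) (m k : ℕ)
    (f : EuclideanSpace ℝ (Fin n) → ℝ)
    (hf : ∀ r : ℝ, 0 < r → ∀ x, f (r • x) = r ^ k * f x) :
    (∫ x : unitSphere (n + 1), (x : EuclideanSpace ℝ (Fin (n + 1))) 0 ^ m *
        f (euclideanTail x.1) ∂(volume : Measure (EuclideanSpace ℝ (Fin (n + 1)))).toSphere) *
      radialGaussianMoment (n + (m + k)) =
    (∫ u : ℝ, u ^ m * Real.exp (-u ^ 2)) *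
      ((∫ y : unitSphere n, f y ∂(volume : Measure (EuclideanSpace ℝ (Fin n))).toSphere) *
        radialGaussianMoment (n - 1 + k)) := by
  have : NeZero n := ⟨hn⟩
  have h1 := integral_homogeneous_mul_gaussian
    (volume : Measure (EuclideanSpace ℝ (Fin (n + 1)))) (m + k)
    (fun x ↦ x 0 ^ m * f (euclideanTail x)) (by
      intro r hr x
      simp only [euclideanTail_smul, hf r hr, PiLp.smul_apply, smul_eq_mul]
      ring)
  have h2 := integral_homogeneous_mul_gaussian
    (volume : Measure (EuclideanSpace ℝ (Fin n))) k f hf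
  simp only [finrank_euclideanSpace, Fintype.card_fin, Nat.add_sub_cancel] at h1 h2
  -- Back to Gaussian integrals, where exp(-‖x‖²) = exp(-x₀²) exp(-‖x'‖²) makes the integrand a
  -- product.
  rw [← h1, ← h2, ← integral_head_mul_tail]
  refine integral_congr_ae (.of_forall fun x ↦ ?_)
  simp only [norm_sq_eq_head_add_tail, neg_add, Real.exp_add]
  ring

instance isProbabilityMeasure_sphereMeasure (n : ℕ) [NeZero n] :
    IsProbabilityMeasure (sphereMeasure n) := by
  constructor
  have h0 : (volume : Measure (EuclideanSpace ℝ (Fin n))).toSphere univ ≠ 0 := by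
    rw [Ne, Measure.measure_univ_eq_zero]
    exact Measure.toSphere_ne_zero _
  rw [sphereMeasure, Measure.smul_apply, smul_eq_mul, ENNReal.inv_mul_cancel h0
    (measure_ne_top _ _)]

/-- The constant relating the two spherical integrals depends only on n, m and k. Comparing f with
‖y‖ᵏ, whose spherical mean is 1, identifies it without computing any Gamma value. -/
theorem sphereMeasure_integral_pow_mul_tail {n : ℕ} (hn : n ≠ 0) (m k : ℕ)
    (f : EuclideanSpace ℝ (Fin n) → ℝ)
    (hf : ∀ r : ℝ, 0 < r → ∀ x, f (r • x) = r ^ k * f x) :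
    ∫ x : unitSphere (n + 1), (x : EuclideanSpace ℝ (Fin (n + 1))) 0 ^ m *
        f (euclideanTail x.1) ∂(sphereMeasure (n + 1)) =
      (∫ x : unitSphere (n + 1), (x : EuclideanSpace ℝ (Fin (n + 1))) 0 ^ m *
        ‖euclideanTail x.1‖ ^ k ∂(sphereMeasure (n + 1))) *
      ∫ y : unitSphere n, f y ∂(sphereMeasure n) := by
  have : NeZero n := ⟨hn⟩
  have h1 := toSphere_integral_pow_mul_tail hn m k f hf
  have h2 := toSphere_integral_pow_mul_tail hn m k (fun y ↦ ‖y‖ ^ k) (by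
    intro r hr x
    simp only [norm_smul, Real.norm_eq_abs, abs_of_pos hr, mul_pow])
  have h3 : ∫ y : unitSphere n, ‖(y : EuclideanSpace ℝ (Fin n))‖ ^ k ∂(sphereMeasure n) = 1 := by
    simp [norm_eq_of_mem_sphere]
  simp only [sphereMeasure, integral_smul_measure, smul_eq_mul] at h3 ⊢
  have hM := (radialGaussianMoment_pos (n + (m + k))).ne'
  rw [← eq_div_iff hM] at h1 h2
  rw [h1, h2]
  generalize (∫ y : unitSphere n, f y ∂(volume : Measure (EuclideanSpace ℝ (Fin n))).toSphere) = F
  generalize (∫ u : ℝ, u ^ m * Real.exp (-u ^ 2)) = A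
  linear_combination (-ENNReal.toReal _ * A * radialGaussianMoment (n - 1 + k) * F /
    radialGaussianMoment (n + (m + k))) * h3

theorem integrable_sphereMeasure {n : ℕ} [NeZero n] {g : EuclideanSpace ℝ (Fin n) → ℝ}
    (hg : Continuous g) : Integrable (fun x : unitSphere n ↦ g x) (sphereMeasure n) := by
  have : CompactSpace (unitSphere n) := isCompact_iff_compactSpace.1 (isCompact_sphere _ _)
  exact (hg.comp continuous_subtype_val).integrable_of_hasCompactSupport
    (HasCompactSupport.of_compactSpace _)

theorem sphereMeasure_integral_polynomial_mul_tail {n : ℕ} (hn : n ≠ 0) (p : Polynomial ℝ) (k : ℕ)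
    (f : EuclideanSpace ℝ (Fin n) → ℝ) (hc : Continuous f)
    (hf : ∀ r : ℝ, 0 < r → ∀ x, f (r • x) = r ^ k * f x) :
    ∫ x : unitSphere (n + 1), p.eval ((x : EuclideanSpace ℝ (Fin (n + 1))) 0) *
        f (euclideanTail x.1) ∂(sphereMeasure (n + 1)) =
      (∫ x : unitSphere (n + 1), p.eval ((x : EuclideanSpace ℝ (Fin (n + 1))) 0) *
        ‖euclideanTail x.1‖ ^ k ∂(sphereMeasure (n + 1))) *
      ∫ y : unitSphere n, f y ∂(sphereMeasure n) := by
  have hct := continuous_euclideanTail (n := n)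
  have hx0 : Continuous fun x : EuclideanSpace ℝ (Fin (n + 1)) ↦ x 0 := by fun_prop
  induction p using Polynomial.induction_on' with
  | add p q hp hq =>
    have I : ∀ (p : Polynomial ℝ) (g : EuclideanSpace ℝ (Fin n) → ℝ), Continuous g →
        Integrable (fun x : unitSphere (n + 1) ↦
          p.eval ((x : EuclideanSpace ℝ (Fin (n + 1))) 0) * g (euclideanTail x.1))
          (sphereMeasure (n + 1)) := fun p g hg ↦
      integrable_sphereMeasure
        (g := fun x : EuclideanSpace ℝ (Fin (n + 1)) ↦ p.eval (x 0) * g (euclideanTail x))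
        ((p.continuous.comp hx0).mul (hg.comp hct))
    have hk : Continuous fun y : EuclideanSpace ℝ (Fin n) ↦ ‖y‖ ^ k := by fun_prop
    simp only [Polynomial.eval_add, add_mul]
    rw [integral_add (I p f hc) (I q f hc), hp, hq, integral_add (I p _ hk) (I q _ hk), add_mul]
  | monomial m c =>
    simp only [Polynomial.eval_monomial, mul_assoc, integral_const_mul]
    rw [sphereMeasure_integral_pow_mul_tail hn m k f hf]

/-- An odd homogeneous function has zero mean over the sphere. -/
theorem sphereMeasure_integral_odd {n : ℕ} (hn : n ≠ 0) (k : ℕ)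
    (f : EuclideanSpace ℝ (Fin n) → ℝ) (hodd : ∀ x, f (-x) = -f x)
    (hf : ∀ r : ℝ, 0 < r → ∀ x, f (r • x) = r ^ k * f x) :
    ∫ y : unitSphere n, f y ∂(sphereMeasure n) = 0 := by
  have : NeZero n := ⟨hn⟩
  have h2 := integral_homogeneous_mul_gaussian
    (volume : Measure (EuclideanSpace ℝ (Fin n))) k f hf
  -- The Gaussian weight and Lebesgue measure are even, so the integral equals its own negative.
  have h3 := integral_neg_eq_self (fun x : EuclideanSpace ℝ (Fin n) ↦ f x * Real.exp (-‖x‖ ^ 2))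
    volume
  simp only [hodd, norm_neg, neg_mul, integral_neg] at h3
  have h4 : ∫ x : EuclideanSpace ℝ (Fin n), f x * Real.exp (-‖x‖ ^ 2) = 0 := by linarith
  rw [h4] at h2
  have h5 := (mul_eq_zero.1 h2.symm).resolve_right (radialGaussianMoment_pos _).ne'
  rw [sphereMeasure, integral_smul_measure, h5, smul_zero]

/-! ### Lifts, slices and inner products -/

theorem euclideanTail_liftPoint {n : ℕ} (β : ℝ) (ξ : EuclideanSpace ℝ (Fin n)) :
    euclideanTail (liftPoint β ξ) = √(1 - β ^ 2) • ξ := by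
  ext i; simp [euclideanTail, liftPoint]

theorem liftPoint_head {n : ℕ} (β : ℝ) (ξ : EuclideanSpace ℝ (Fin n)) :
    liftPoint β ξ 0 = β := by
  simp [liftPoint]

theorem liftPoint_injective {n : ℕ} {β : ℝ} (hβ : β ^ 2 < 1) :
    Function.Injective (liftPoint (n := n) β) := by
  intro ξ η h
  have h' := congrArg euclideanTail h
  rw [euclideanTail_liftPoint, euclideanTail_liftPoint] at h'
  exact smul_right_injective _ (Real.sqrt_pos.2 (sub_pos.2 hβ)).ne' h'

theorem inner_eq_head_mul_add_inner_tail {n : ℕ} (x y : EuclideanSpace ℝ (Fin (n + 1))) :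
    inner ℝ x y = x 0 * y 0 + inner ℝ (euclideanTail x) (euclideanTail y) := by
  simp [PiLp.inner_apply, Fin.sum_univ_succ, euclideanTail, mul_comm]

theorem inner_firstBasisVector {n : ℕ} (x : EuclideanSpace ℝ (Fin (n + 1))) :
    inner ℝ (firstBasisVector n) x = x 0 := by
  simp [firstBasisVector, EuclideanSpace.inner_single_left]

theorem euclidean_ext_head_tail {n : ℕ} {x y : EuclideanSpace ℝ (Fin (n + 1))} (h0 : x 0 = y 0)
    (ht : euclideanTail x = euclideanTail y) : x = y := by
  ext i
  refine Fin.cases h0 (fun j ↦ ?_) i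
  simpa [euclideanTail] using congrArg (fun z : EuclideanSpace ℝ (Fin n) ↦ z j) ht

theorem firstBasisVector_head (n : ℕ) : firstBasisVector n 0 = 1 := by
  simp [firstBasisVector]

theorem euclideanTail_firstBasisVector (n : ℕ) : euclideanTail (firstBasisVector n) = 0 := by
  ext i; simp [firstBasisVector, euclideanTail]

/-- A point of the sphere other than `±(1, 0, …, 0)` has first coordinate in `(-1, 1)`. -/
theorem head_sq_lt_one {n : ℕ} {x : EuclideanSpace ℝ (Fin (n + 1))}
    (hx : x ∈ unitSphere (n + 1)) (hpos : x ≠ firstBasisVector n)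
    (hneg : x ≠ -firstBasisVector n) : x 0 ^ 2 < 1 := by
  have h := norm_sq_eq_head_add_tail x
  rw [mem_sphere_zero_iff_norm.1 hx] at h
  refine lt_of_le_of_ne (by nlinarith [sq_nonneg ‖euclideanTail x‖]) fun h1 ↦ ?_
  have ht : euclideanTail x = 0 := by
    rw [← norm_eq_zero, ← sq_eq_zero_iff]
    linarith
  rcases eq_or_eq_neg_of_sq_eq_sq (x 0) 1 (by rw [h1, one_pow]) with h0 | h0
  · exact hpos (euclidean_ext_head_tail (by rw [h0, firstBasisVector_head])
      (by rw [ht, euclideanTail_firstBasisVector]))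
  · refine hneg (euclidean_ext_head_tail ?_ ?_)
    · rw [h0, PiLp.neg_apply, firstBasisVector_head]
    · rw [ht, ← neg_one_smul ℝ, euclideanTail_smul, euclideanTail_firstBasisVector, smul_zero]

/-- The lifted derived code is the slice of the code at height `β`. -/
theorem image_liftPoint_derivedCode {n : ℕ} {X : Set (EuclideanSpace ℝ (Fin (n + 1)))}
    (hX : X ⊆ unitSphere (n + 1)) {β : ℝ} (hβ : β ^ 2 < 1) :
    liftPoint β '' derivedCode X β = {x | x ∈ X ∧ x 0 = β} := by
  ext x
  constructor
  · rintro ⟨ξ, ⟨-, h⟩, rfl⟩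
    exact ⟨h, liftPoint_head β ξ⟩
  · rintro ⟨hx, rfl⟩
    have hr := Real.sqrt_pos.2 (sub_pos.2 hβ)
    have hlift : liftPoint (x 0) ((√(1 - x 0 ^ 2))⁻¹ • euclideanTail x) = x :=
      euclidean_ext_head_tail (liftPoint_head _ _)
        (by rw [euclideanTail_liftPoint, smul_inv_smul₀ hr.ne'])
    refine ⟨(√(1 - x 0 ^ 2))⁻¹ • euclideanTail x, ⟨?_, by rwa [hlift]⟩, hlift⟩
    have h := norm_sq_eq_head_add_tail x
    rw [mem_sphere_zero_iff_norm.1 (hX hx)] at h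
    have ht : √(1 - x 0 ^ 2) = ‖euclideanTail x‖ := by
      rw [← Real.sqrt_sq (norm_nonneg (euclideanTail x))]
      congr 1
      linarith
    rw [mem_sphere_zero_iff_norm, norm_smul, norm_inv, Real.norm_eq_abs, abs_of_pos hr, ← ht,
      inv_mul_cancel₀ hr.ne']

theorem angleSet_derivedCode_subset {n : ℕ} (X : Set (EuclideanSpace ℝ (Fin (n + 1))))
    {β₁ β₂ : ℝ} (h₁ : β₁ ^ 2 < 1) (h₂ : β₂ ^ 2 < 1) :
    angleSet (derivedCode X β₁) (derivedCode X β₂) ⊆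
      {c | ∃ γ ∈ angleSet X X, c = (γ - β₁ * β₂) / √((1 - β₁ ^ 2) * (1 - β₂ ^ 2))} := by
  rintro c ⟨ξ, hξ, η, hη, hne, rfl⟩
  refine ⟨_, ⟨liftPoint β₁ ξ, hξ.2, liftPoint β₂ η, hη.2, fun h ↦ ?_, rfl⟩, ?_⟩
  -- Equal lifts would have equal heights, and then injectivity at that height would give ξ = η.
  · have hβ : β₁ = β₂ := by rw [← liftPoint_head β₁ ξ, h, liftPoint_head]
    subst hβ
    exact hne (liftPoint_injective h₁ h)
  · have hr₁ := Real.sqrt_pos.2 (sub_pos.2 h₁)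
    have hr₂ := Real.sqrt_pos.2 (sub_pos.2 h₂)
    rw [inner_eq_head_mul_add_inner_tail, liftPoint_head, liftPoint_head,
      euclideanTail_liftPoint, euclideanTail_liftPoint, inner_smul_left, inner_smul_right,
      Real.sqrt_mul (sub_pos.2 h₁).le]
    simp only [conj_trivial]
    field_simp
    ring

/-! ### Test polynomials and sums over a slice -/

theorem finsum_derivedCode {n : ℕ} {X : Set (EuclideanSpace ℝ (Fin (n + 1)))}
    (hX : X ⊆ unitSphere (n + 1)) {β : ℝ} (hβ : β ^ 2 < 1)
    (g : EuclideanSpace ℝ (Fin (n + 1)) → ℝ) (hg : ∀ x ∈ X, x 0 ≠ β → g x = 0) :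
    ∑ᶠ x ∈ X, g x = ∑ᶠ ξ ∈ derivedCode X β, g (liftPoint β ξ) := by
  rw [← finsum_mem_image (liftPoint_injective hβ).injOn, image_liftPoint_derivedCode hX hβ]
  refine finsum_mem_inter_support_eq' _ _ _ fun x hx ↦ ⟨fun h ↦ ⟨h, ?_⟩, fun h ↦ h.1⟩
  by_contra h0
  exact hx (hg x h h0)

theorem totalDegree_aeval_X_le {σ : Type*} (i : σ) (p : Polynomial ℝ) :
    (Polynomial.aeval (MvPolynomial.X i : MvPolynomial σ ℝ) p).totalDegree ≤ p.natDegree := by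
  rw [Polynomial.aeval_eq_sum_range]
  refine MvPolynomial.totalDegree_finsetSum_le fun k hk ↦ ?_
  refine (MvPolynomial.totalDegree_smul_le _ _).trans ?_
  rw [MvPolynomial.totalDegree_X_pow]
  exact Nat.lt_succ_iff.1 (Finset.mem_range.1 hk)

theorem eval_aeval_X {σ : Type*} (i : σ) (p : Polynomial ℝ) (x : σ → ℝ) :
    MvPolynomial.eval x (Polynomial.aeval (MvPolynomial.X i : MvPolynomial σ ℝ) p) =
      p.eval (x i) := by
  rw [← MvPolynomial.coe_aeval_eq_eval, RingHom.coe_coe, ← Polynomial.aeval_algHom_apply]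
  simp

theorem IsSphericalDesign.integral_head_mul_tail {n t : ℕ}
    {X : Set (EuclideanSpace ℝ (Fin (n + 1)))} (hX : IsSphericalDesign t X) (p : Polynomial ℝ)
    (f : MvPolynomial (Fin n) ℝ) (h : p.natDegree + f.totalDegree ≤ t) :
    ∫ x : unitSphere (n + 1), p.eval ((x : EuclideanSpace ℝ (Fin (n + 1))) 0) *
        MvPolynomial.eval (euclideanTail x.1).ofLp f ∂(sphereMeasure (n + 1)) =
      (1 / (X.ncard : ℝ)) *
        ∑ᶠ x ∈ X, p.eval (x 0) * MvPolynomial.eval (euclideanTail x).ofLp f := by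
  have h' := hX.integral_eq_average
    (Polynomial.aeval (MvPolynomial.X 0) p * MvPolynomial.rename Fin.succ f)
    ((MvPolynomial.totalDegree_mul _ _).trans ((add_le_add (totalDegree_aeval_X_le _ _)
      (MvPolynomial.totalDegree_rename_le _ _)).trans h))
  simp only [map_mul, eval_aeval_X, MvPolynomial.eval_rename] at h'
  exact h'

theorem MvPolynomial.IsHomogeneous.eval_smul_euclidean {n k : ℕ} {f : MvPolynomial (Fin n) ℝ}
    (hf : f.IsHomogeneous k) (r : ℝ) (x : EuclideanSpace ℝ (Fin n)) :
    MvPolynomial.eval (r • x).ofLp f = r ^ k * MvPolynomial.eval x.ofLp f := by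
  have : (r • x).ofLp = fun i ↦ r * x i := by ext i; simp
  rw [this]
  simp only [MvPolynomial.eval_eq, Finset.mul_sum]
  refine Finset.sum_congr rfl fun d hd ↦ ?_
  have hk : ∑ i ∈ d.support, d i = k := by
    rw [← hf (MvPolynomial.mem_support_iff.1 hd)]
    exact (DFunLike.congr_fun Finsupp.degree_eq_weight_one d :)
  simp only [mul_pow, Finset.prod_mul_distrib, Finset.prod_pow_eq_pow_sum, hk]
  ring

theorem continuous_eval_euclidean {n : ℕ} (f : MvPolynomial (Fin n) ℝ) :
    Continuous fun x : EuclideanSpace ℝ (Fin n) ↦ MvPolynomial.eval x.ofLp f :=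
  (MvPolynomial.continuous_eval f).comp (PiLp.continuous_ofLp 2 _)

/-! ### Design property of the derived codes -/

/-- Exactness of the derived code for a homogeneous polynomial, given a polynomial in one
variable that vanishes at the other heights. -/
theorem derivedCode_average_homogeneous {n t k : ℕ} (hn : n ≠ 0)
    {X : Set (EuclideanSpace ℝ (Fin (n + 1)))} (hX : IsSphericalDesign t X) {β : ℝ}
    (hβ : β ^ 2 < 1) (hD : (derivedCode X β).Finite) (hD0 : (derivedCode X β).Nonempty)
    (q : Polynomial ℝ) (hq : q.eval β ≠ 0) (hq0 : ∀ x ∈ X, x 0 ≠ β → q.eval (x 0) = 0)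
    (hk : q.natDegree + k ≤ t) (f : MvPolynomial (Fin n) ℝ) (hf : f.IsHomogeneous k) :
    ∫ y : unitSphere n, MvPolynomial.eval (y : EuclideanSpace ℝ (Fin n)).ofLp f
        ∂(sphereMeasure n) =
      (1 / ((derivedCode X β).ncard : ℝ)) *
        ∑ᶠ ξ ∈ derivedCode X β, MvPolynomial.eval ξ.ofLp f := by
  have hr := Real.sqrt_pos.2 (sub_pos.2 hβ)
  have hN : (X.ncard : ℝ) ≠ 0 :=
    Nat.cast_ne_zero.2 ((Set.ncard_pos hX.finite).2 hX.nonempty).ne'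
  have hM : ((derivedCode X β).ncard : ℝ) ≠ 0 :=
    Nat.cast_ne_zero.2 ((Set.ncard_pos hD).2 hD0).ne'
  have h1 := hX.integral_head_mul_tail q f (by
    have := hf.totalDegree_le
    omega)
  rw [finsum_derivedCode hX.subset_sphere hβ _ fun x hx h0 ↦ by rw [hq0 x hx h0, zero_mul]] at h1
  simp only [liftPoint_head, euclideanTail_liftPoint, hf.eval_smul_euclidean,
    ← mul_finsum_mem] at h1
  rw [sphereMeasure_integral_polynomial_mul_tail hn q k _ (continuous_eval_euclidean f)
    fun r _ x ↦ hf.eval_smul_euclidean r x] at h1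
  rcases Nat.even_or_odd' k with ⟨j, rfl | rfl⟩
  -- Even k = 2j: this second test polynomial, of degree at most deg q + 2j, evaluates the factor ∫
  -- q(x₀) ‖x'‖ᵏ.
  · have h2 := hX.integral_head_mul_tail (q * (1 - Polynomial.X ^ 2) ^ j) 1 (by
      rw [MvPolynomial.totalDegree_one, add_zero]
      refine Polynomial.natDegree_mul_le.trans ((Nat.add_le_add_left ?_ _).trans hk)
      rw [mul_comm 2 j]
      refine Polynomial.natDegree_pow_le_of_le j ?_
      compute_degree)
    rw [finsum_derivedCode hX.subset_sphere hβ _ fun x hx h0 ↦ by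
      rw [Polynomial.eval_mul, hq0 x hx h0, zero_mul, zero_mul]] at h2
    simp only [liftPoint_head, map_one, mul_one, Polynomial.eval_mul, Polynomial.eval_pow,
      Polynomial.eval_sub, Polynomial.eval_one, Polynomial.eval_X] at h2
    have h3 : ∀ x : unitSphere (n + 1), ‖euclideanTail x.1‖ ^ (2 * j) =
        (1 - (x : EuclideanSpace ℝ (Fin (n + 1))) 0 ^ 2) ^ j := fun x ↦ by
      have h := norm_sq_eq_head_add_tail x.1
      rw [mem_sphere_zero_iff_norm.1 x.2] at h
      rw [pow_mul]
      congr 1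
      linarith
    simp only [h3] at h1
    rw [h2, finsum_mem_eq_finite_toFinset_sum _ hD, Finset.sum_const,
      ← Set.ncard_eq_toFinset_card _ hD, nsmul_eq_mul, pow_mul, Real.sq_sqrt (sub_pos.2 hβ).le]
      at h1
    have hp : (1 - β ^ 2) ^ j ≠ 0 := pow_ne_zero _ (sub_pos.2 hβ).ne'
    field_simp at h1 ⊢
    linear_combination h1
  -- Odd k: the integral side vanishes, and the nonzero factors multiplying the slice sum cancel.
  · have hodd : ∀ x : EuclideanSpace ℝ (Fin n), MvPolynomial.eval (-x).ofLp f =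
        -MvPolynomial.eval x.ofLp f := fun x ↦ by
      rw [← neg_one_smul ℝ x, hf.eval_smul_euclidean, (odd_two_mul_add_one j).neg_one_pow,
        neg_one_mul]
    rw [sphereMeasure_integral_odd hn _
      (fun x ↦ MvPolynomial.eval x.ofLp f) hodd fun r _ x ↦ hf.eval_smul_euclidean r x] at h1 ⊢
    have hp : √(1 - β ^ 2) ^ (2 * j + 1) ≠ 0 := pow_ne_zero _ hr.ne'
    rw [mul_zero, eq_comm] at h1
    simp only [mul_eq_zero, hq, hp, one_div, inv_eq_zero, hN, false_or] at h1
    rw [h1, mul_zero]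

theorem isSphericalDesign_of_homogeneous {n t : ℕ} (hn : n ≠ 0)
    {X : Set (EuclideanSpace ℝ (Fin n))} (hfin : X.Finite) (hne : X.Nonempty)
    (hX : X ⊆ unitSphere n)
    (h : ∀ k ≤ t, ∀ f : MvPolynomial (Fin n) ℝ, f.IsHomogeneous k →
      ∫ y : unitSphere n, MvPolynomial.eval (y : EuclideanSpace ℝ (Fin n)).ofLp f
        ∂(sphereMeasure n) = (1 / (X.ncard : ℝ)) * ∑ᶠ ξ ∈ X, MvPolynomial.eval ξ.ofLp f) :
    IsSphericalDesign t X := by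
  refine ⟨hfin, hne, hX, fun f hf ↦ ?_⟩
  have : NeZero n := ⟨hn⟩
  rw [← f.sum_homogeneousComponent]
  simp only [map_sum]
  rw [integral_finsetSum _ fun i _ ↦ integrable_sphereMeasure (continuous_eval_euclidean _),
    Finset.sum_congr rfl fun k hk ↦ h k ((Nat.lt_succ_iff.1 (Finset.mem_range.1 hk)).trans hf) _
      (f.homogeneousComponent_isHomogeneous k)]
  simp only [finsum_mem_eq_finite_toFinset_sum _ hfin]
  rw [← Finset.mul_sum, Finset.sum_comm]

theorem isSphericalDesign_zero {n : ℕ} (hn : n ≠ 0) {X : Set (EuclideanSpace ℝ (Fin n))}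
    (hfin : X.Finite) (hne : X.Nonempty) (hX : X ⊆ unitSphere n) : IsSphericalDesign 0 X := by
  refine ⟨hfin, hne, hX, fun f hf ↦ ?_⟩
  have : NeZero n := ⟨hn⟩
  have hN : (X.ncard : ℝ) ≠ 0 := Nat.cast_ne_zero.2 ((Set.ncard_pos hfin).2 hne).ne'
  rw [MvPolynomial.totalDegree_eq_zero_iff_eq_C.1 (Nat.le_zero.1 hf)]
  simp only [MvPolynomial.eval_C]
  rw [finsum_mem_eq_finite_toFinset_sum _ hfin, Finset.sum_const,
    ← Set.ncard_eq_toFinset_card _ hfin]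
  simp [hN]

/-- The numerator of the Lagrange basis polynomial at β. -/
theorem exists_polynomial_vanishing_off {B : Set ℝ} (hB : B.Finite) {β : ℝ} (hβ : β ∈ B) :
    ∃ q : Polynomial ℝ, q.natDegree + 1 = B.ncard ∧ q.eval β ≠ 0 ∧
      ∀ b ∈ B, b ≠ β → q.eval b = 0 := by
  classical
  refine ⟨∏ b ∈ hB.toFinset.erase β, (Polynomial.X - Polynomial.C b), ?_, ?_, fun b hb hne ↦ ?_⟩
  · rw [Polynomial.natDegree_finsetProd_X_sub_C_eq_card,
      Finset.card_erase_add_one (hB.mem_toFinset.2 hβ), Set.ncard_eq_toFinset_card _ hB]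
  · rw [Polynomial.eval_prod, Finset.prod_ne_zero_iff]
    intro b hb
    simpa [sub_eq_zero] using (Finset.ne_of_mem_erase hb).symm
  · rw [Polynomial.eval_prod]
    exact Finset.prod_eq_zero (Finset.mem_erase.2 ⟨hne, hB.mem_toFinset.2 hb⟩) (by simp)

end

theorem mainTheorem7 (n : ℕ) (X : Set (EuclideanSpace ℝ (Fin (n + 1))))
    (hfin : X.Finite) (hne : X.Nonempty) (hX : X ⊆ unitSphere (n + 1))
    (hpos : firstBasisVector n ∉ X) (hneg : -firstBasisVector n ∉ X)
    (B : Set ℝ) (hB : B = {b | ∃ x ∈ X, inner ℝ (firstBasisVector n) x = b})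
    (s : ℕ) (hs : s = B.ncard) :
    (∀ β₁ ∈ B, ∀ β₂ ∈ B,
      angleSet (derivedCode X β₁) (derivedCode X β₂) ⊆
        {c | ∃ γ ∈ angleSet X X,
          c = (γ - β₁ * β₂) / √((1 - β₁ ^ 2) * (1 - β₂ ^ 2))}) ∧
    (∀ t : ℕ, IsSphericalDesign t X →
      ∀ β ∈ B, IsSphericalDesign (t + 1 - s) (derivedCode X β)) := by
  have hB' : B = (fun x : EuclideanSpace ℝ (Fin (n + 1)) ↦ x 0) '' X := by
    rw [hB]
    simp only [inner_firstBasisVector]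
    rfl
  have hlt : ∀ β ∈ B, β ^ 2 < 1 := by
    rw [hB']
    rintro _ ⟨x, hx, rfl⟩
    exact head_sq_lt_one (hX hx) (fun h ↦ hpos (h ▸ hx)) (fun h ↦ hneg (h ▸ hx))
  refine ⟨fun β₁ h₁ β₂ h₂ ↦ angleSet_derivedCode_subset X (hlt β₁ h₁) (hlt β₂ h₂),
    fun t ht β hβ ↦ ?_⟩
  have himage := image_liftPoint_derivedCode hX (hlt β hβ)
  have hD : (derivedCode X β).Finite := by
    refine Set.Finite.of_finite_image ?_ (liftPoint_injective (hlt β hβ)).injOn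
    rw [himage]
    exact hfin.subset fun x hx ↦ hx.1
  have hD0 : (derivedCode X β).Nonempty := by
    rw [← Set.image_nonempty (f := liftPoint β), himage]
    rw [hB'] at hβ
    obtain ⟨x, hx, h⟩ := hβ
    exact ⟨x, hx, h⟩
  have hDs : derivedCode X β ⊆ unitSphere n := fun ξ hξ ↦ hξ.1
  -- The unit sphere of ℝ⁰ is empty, while the derived code is not.
  have hn : n ≠ 0 := by
    rintro rfl
    obtain ⟨ξ, hξ⟩ := hD0
    have := mem_sphere_zero_iff_norm.1 (hDs hξ)
    rw [Subsingleton.elim ξ 0, norm_zero] at this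
    exact zero_ne_one this
  -- If t < s, the truncated difference t + 1 - s is 0 and only constants need testing; q may then
  -- have degree above t. Otherwise k ≤ t + 1 - s gives deg q + k ≤ t.
  rcases Nat.lt_or_ge t s with hts | hts
  · rw [Nat.sub_eq_zero_of_le hts]
    exact isSphericalDesign_zero hn hD hD0 hDs
  obtain ⟨q, hqs, hq, hq0⟩ := exists_polynomial_vanishing_off (hB' ▸ hfin.image _) hβ
  refine isSphericalDesign_of_homogeneous hn hD hD0 hDs fun k hk f hf ↦
    derivedCode_average_homogeneous hn ht (hlt β hβ) hD hD0 q hq (fun x hx ↦ hq0 _ ?_)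
      (by omega) f hf
  rw [hB']
  exact ⟨x, hx, rfl⟩
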